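/- Let $(M,g)$ be a smooth pseudo-Riemannian manifold of dimension $n$ (that is, $g$ is a smooth field of symmetric nondegenerate bilinear forms $\langle\cdot,\cdot\rangle$ on the tangent spaces, of arbitrary signature), and let $\nabla$ be its Levi-Civita connection, i.e. the connection on the tangent bundle with $\nabla_XY-\nabla_YX=[X,Y]$ and $X\langle Y,Z\rangle=\langle\nabla_XY,Z\rangle+\langle Y,\nabla_XZ\rangle$. Let $R(X,Y)Z=\nabla_X\nabla_YZ-\nabla_Y\nabla_XZ-\nabla_{[X,Y]}Z$ be its curvature. In local coordinates $(x^1,\dots,x^n)$ put (summing over repeated indices) $\nabla_{\partial_i}\partial_j=\Gamma^k_{ij}\partial_k$, $R(\partial_i,\partial_j)\partial_k=R^l_{kij}\partial_l$, let $R_{kj}=R^s_{jsk}$ be the Ricci tensor, $R=g^{ij}R_{ij}$ the scalar curvature, and $$G_{ij}=R_{ij}-\tfrac12 g_{ij}R,\qquad G^i_j=g^{ik}G_{kj}$$ the Hilbert–Einstein–Cartan tensor and its mixed version. The divergence of a tensor $T^i_j$ is $(\operatorname{div}T)_j=T^i_{j/i}$, where $T^i_{j/k}=\frac{\partial T^i_j}{\partial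 x^k}+\Gamma^i_{k\alpha}T^\alpha_j-\Gamma^\alpha_{kj}T^i_\alpha$. Then the divergence of the Hilbert–Einstein–Cartan tensor is zero: in every chart of $M$, at every point of its domain and for every $j\in\{1,\dots,n\}$, $$G^i_{j/i}=0 .$$ -/

import Mathlib

open scoped Manifold ContDiff Bundle

noncomputable section

namespace PseudoRiemannian

/-- A smooth pseudo-Riemannian metric on an `n`-dimensional manifold `M`: a smooth field of
symmetric nondegenerate bilinear forms on the tangent spaces (of arbitrary signature). -/
structure Metric (n : ℕ) (M : Type*) [TopologicalSpace M]
    [ChartedSpace (EuclideanSpace ℝ (Fin n)) M] [IsManifold (𝓡 n) ∞ M] where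
  /-- The bilinear form `⟨·, ·⟩` on the tangent space at `x`. -/
  inner (x : M) : TangentSpace (𝓡 n) x →L[ℝ] TangentSpace (𝓡 n) x →L[ℝ] ℝ
  symm (x : M) (v w : TangentSpace (𝓡 n) x) : inner x v w = inner x w v
  nondegenerate (x : M) (v : TangentSpace (𝓡 n) x) (hv : ∀ w, inner x v w = 0) : v = 0
  contMDiff : ContMDiff (𝓡 n)
    ((𝓡 n).prod 𝓘(ℝ, EuclideanSpace ℝ (Fin n) →L[ℝ] EuclideanSpace ℝ (Fin n) →L[ℝ] ℝ)) ∞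
    (fun x ↦ Bundle.TotalSpace.mk'
      (EuclideanSpace ℝ (Fin n) →L[ℝ] EuclideanSpace ℝ (Fin n) →L[ℝ] ℝ) x (inner x))

variable {n : ℕ} {M : Type*} [TopologicalSpace M]
  [ChartedSpace (EuclideanSpace ℝ (Fin n)) M] [IsManifold (𝓡 n) ∞ M]

/-- A connection on the tangent bundle of `M`. In Mathlib's convention `nabla Y x (X x)` is
`(∇_X Y)(x)`. -/
abbrev Connection (n : ℕ) (M : Type*) [TopologicalSpace M]
    [ChartedSpace (EuclideanSpace ℝ (Fin n)) M] [IsManifold (𝓡 n) ∞ M] :=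
  CovariantDerivative (𝓡 n) (EuclideanSpace ℝ (Fin n)) (TangentSpace (𝓡 n) : M → Type _)

/-- `nabla` is the Levi-Civita connection of `g`: it is symmetric (`∇_X Y - ∇_Y X = [X, Y]`) and
compatible with the metric (`X⟨Y, Z⟩ = ⟨∇_X Y, Z⟩ + ⟨Y, ∇_X Z⟩`). -/
structure IsLeviCivita (g : Metric n M) (nabla : Connection n M) : Prop where
  symmetric : ∀ (x : M) (X Y : Π y : M, TangentSpace (𝓡 n) y),
    MDifferentiableAt (𝓡 n) (𝓡 n).tangent (T% X) x →
    MDifferentiableAt (𝓡 n) (𝓡 n).tangent (T% Y) x →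
    nabla Y x (X x) - nabla X x (Y x) = VectorField.mlieBracket (𝓡 n) X Y x
  compatible : ∀ (x : M) (X Y Z : Π y : M, TangentSpace (𝓡 n) y),
    MDifferentiableAt (𝓡 n) (𝓡 n).tangent (T% Y) x →
    MDifferentiableAt (𝓡 n) (𝓡 n).tangent (T% Z) x →
    mvfderiv (𝓡 n) (fun y ↦ g.inner y (Y y) (Z y)) x (X x) =
      g.inner x (nabla Y x (X x)) (Z x) + g.inner x (Y x) (nabla Z x (X x))

/-- The curvature operator `R(X, Y)Z = ∇_X ∇_Y Z - ∇_Y ∇_X Z - ∇_{[X, Y]} Z` of a connection. -/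
def curvature (nabla : Connection n M) (X Y Z : Π y : M, TangentSpace (𝓡 n) y) (x : M) :
    TangentSpace (𝓡 n) x :=
  nabla (fun y ↦ nabla Z y (Y y)) x (X x) - nabla (fun y ↦ nabla Z y (X y)) x (Y x)
    - nabla Z x (VectorField.mlieBracket (𝓡 n) X Y x)

/-! ### Components in a chart

In what follows `φ = (x¹, …, xⁿ)` is a chart of `M`; the objects below are meaningful on its
domain `φ.source`. -/

variable (φ : OpenPartialHomeomorph M (EuclideanSpace ℝ (Fin n)))

/-- The coordinate vector field `∂/∂xⁱ`: the pull-back by the chart of the constant field `eᵢ`. -/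
def coordField (i : Fin n) : Π x : M, TangentSpace (𝓡 n) x :=
  VectorField.mpullback (𝓡 n) (𝓡 n) φ
    (fun _ ↦ (EuclideanSpace.single i (1 : ℝ) : EuclideanSpace ℝ (Fin n)))

/-- The coordinate `1`-form `dxᵏ` at `x`; `coordForm φ k x v` is the `k`-th component of `v`. -/
def coordForm (k : Fin n) (x : M) : TangentSpace (𝓡 n) x →L[ℝ] ℝ :=
  mvfderiv (𝓡 n) (fun y : M ↦ φ y k) x

/-- The partial derivative `∂f/∂xⁱ` of a function on `M`. -/
def partialDeriv (i : Fin n) (f : M → ℝ) (x : M) : ℝ :=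
  mvfderiv (𝓡 n) f x (coordField φ i x)

/-- The matrix `(g_{ij})` of the metric, `g_{ij} = ⟨∂/∂xⁱ, ∂/∂xʲ⟩`. -/
def metricMatrix (g : Metric n M) (x : M) : Matrix (Fin n) (Fin n) ℝ :=
  Matrix.of fun i j ↦ g.inner x (coordField φ i x) (coordField φ j x)

/-- The inverse matrix `(g^{ij})`. -/
def metricInv (g : Metric n M) (x : M) : Matrix (Fin n) (Fin n) ℝ :=
  (metricMatrix φ g x)⁻¹

/-- The connection coefficient `Γᵏ_{ij}`, defined by `∇_{∂_i} ∂_j = Γᵏ_{ij} ∂_k`. -/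
def christoffel (nabla : Connection n M) (k i j : Fin n) (x : M) : ℝ :=
  coordForm φ k x (nabla (coordField φ j) x (coordField φ i x))

/-- The component `Rˡ_{kij}` of the curvature tensor, defined by `R(∂_i, ∂_j)∂_k = Rˡ_{kij} ∂_l`. -/
def curvatureComp (nabla : Connection n M) (l k i j : Fin n) (x : M) : ℝ :=
  coordForm φ l x (curvature nabla (coordField φ i) (coordField φ j) (coordField φ k) x)

/-- The component `R_{kj} = Rˢ_{jsk}` of the Ricci tensor, i.e. the trace of
`Y ↦ R(Y, ∂_k)∂_j`. -/
def ricci (nabla : Connection n M) (k j : Fin n) (x : M) : ℝ :=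
  ∑ s, curvatureComp φ nabla s j s k x

/-- The scalar curvature `R = g^{ij} R_{ij}`. -/
def scalarCurvature (g : Metric n M) (nabla : Connection n M) (x : M) : ℝ :=
  ∑ i, ∑ j, metricInv φ g x i j * ricci φ nabla i j x

/-- The component `G_{ij} = R_{ij} - ½ g_{ij} R` of the (twice covariant)
Hilbert–Einstein–Cartan tensor. -/
def hec (g : Metric n M) (nabla : Connection n M) (i j : Fin n) (x : M) : ℝ :=
  ricci φ nabla i j x - 1 / 2 * metricMatrix φ g x i j * scalarCurvature φ g nabla x

/-- The component `Gⁱ_j = g^{ik} G_{kj}` of the mixed version of the Hilbert–Einstein–Cartan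
tensor. -/
def hecMixed (g : Metric n M) (nabla : Connection n M) (i j : Fin n) (x : M) : ℝ :=
  ∑ k, metricInv φ g x i k * hec φ g nabla k j x

/-- The component
`Tⁱ_{j/k} = ∂Tⁱ_j/∂xᵏ + Γⁱ_{kα} T^α_j - Γ^α_{kj} Tⁱ_α` of the covariant derivative of the tensor
with components `Tⁱ_j = T i j` (once contravariant and once covariant). -/
def covDerivComp (nabla : Connection n M) (T : Fin n → Fin n → M → ℝ) (i j k : Fin n) (x : M) :
    ℝ :=
  partialDeriv φ k (T i j) x + ∑ a, christoffel φ nabla i k a x * T a j x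
    - ∑ a, christoffel φ nabla a k j x * T i a x

/-- The component `(div T)_j = Tⁱ_{j/i}` of the divergence. -/
def divergence (nabla : Connection n M) (T : Fin n → Fin n → M → ℝ) (j : Fin n) (x : M) : ℝ :=
  ∑ i, covDerivComp φ nabla T i j i x

end PseudoRiemannian

end

/-!
The proof reduces the tensor identity to a computation in a commutative algebra with commuting
derivations, and then supplies that algebra by calculus in the chart.

*Algebra.* Let `D_i` be commuting derivations of a commutative `ℝ`-algebra, and let `Γ_i` be square
matrices with entries `(Γ_i)ˡ_k = Γˡ_{ik}`. The curvature is the matrix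
`F_{ij} = D_i Γ_j - D_j Γ_i + [Γ_i, Γ_j]`, so that the second Bianchi identity is a short
noncommutative calculation (`covDerivEnd_curvatureMatrix_cyclic`); torsion-freeness turns it into
the identity for the full covariant derivative `∇_a F_{bc}` (`covDerivCurvature_cyclic`). Let `g` be
the metric and `P` its inverse. Metric compatibility makes the matrices `F_{bc} P`, and hence
`(∇_a F_{bc}) P`, skew. Contracting the second Bianchi identity once with the trace and once with
`P`, one term becomes `D_a R`; the two others become `-∇^b R_{ba}` each, one by the antisymmetry of
`F` in its form indices, the other by skewness. This gives `D_a R = 2 ∇^b R_{ba}`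
(`derivation_trace_ricci`), which is the vanishing of the divergence (`divergence_einstein`). The
symmetry of the Ricci tensor, used on the way, follows from the first Bianchi identity and
`tr F_{ij} = 0`; the pair symmetry of the curvature is not needed.

*Calculus.* For a chart `φ`, the algebra consists of the functions on `M` that are smooth on
`φ.source`, and `D_i` is `∂/∂xⁱ`, extended by zero off `φ.source` so as to remain a derivation. A
connection is not assumed to be smooth, but the Koszul formula expresses the Christoffel symbols of
the Levi-Civita connection through the metric (`contMDiffOn_christoffel`), so they belong to the
algebra. Locality and the Leibniz rule give the usual coordinate expression of the curvature
(`curvatureComp_eq`), which identifies the components in the chart with the values of the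
algebraic objects.
-/

noncomputable section

namespace PseudoRiemannian.Algebraic

open Matrix

/-! ### Curvature identities over an algebra with derivations -/

variable {ι A : Type*} [CommRing A] [Algebra ℝ A]

theorem map_derivation_mul [Fintype ι] (d : Derivation ℝ A A) (X Y : Matrix ι ι A) :
    (X * Y).map d = X.map d * Y + X * Y.map d := by
  ext i j
  simp only [map_apply, mul_apply, map_sum, Derivation.leibniz, smul_eq_mul, Matrix.add_apply,
    Finset.sum_add_distrib]
  rw [add_comm]
  congr 1
  exact Finset.sum_congr rfl fun k _ ↦ mul_comm _ _

theorem map_derivation_add (d : Derivation ℝ A A) (X Y : Matrix ι ι A) :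
    (X + Y).map d = X.map d + Y.map d := by
  ext; simp

theorem map_derivation_sub (d : Derivation ℝ A A) (X Y : Matrix ι ι A) :
    (X - Y).map d = X.map d - Y.map d := by
  ext; simp

theorem map_derivation_one [DecidableEq ι] (d : Derivation ℝ A A) :
    (1 : Matrix ι ι A).map d = 0 := by
  ext i j
  by_cases h : i = j <;> simp [h]

variable [Fintype ι] (D : ι → Derivation ℝ A A) (Γ : ι → Matrix ι ι A)

/-- The curvature matrices `F_{ij}`, with entries `(F_{ij})ˡ_k = Rˡ_{kij}`, of the connection
matrices `Γ_i`, with entries `(Γ_i)ˡ_k = Γˡ_{ik}`. -/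
def curvatureMatrix (i j : ι) : Matrix ι ι A :=
  (Γ j).map (D i) - (Γ i).map (D j) + Γ i * Γ j - Γ j * Γ i

/-- The covariant derivative in the direction `a` of a field of endomorphisms. -/
def covDerivEnd (a : ι) (X : Matrix ι ι A) : Matrix ι ι A :=
  X.map (D a) + Γ a * X - X * Γ a

/-- The covariant derivative in the direction `a` of a field of bilinear forms. -/
def covDerivForm (a : ι) (X : Matrix ι ι A) : Matrix ι ι A :=
  X.map (D a) - (Γ a)ᵀ * X - X * Γ a

/-- The Ricci matrix `S`, with entries `S_{cd} = (F_{bc})ᵇ_d`. -/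
def ricciMatrix : Matrix ι ι A :=
  Matrix.of fun c d ↦ ∑ b, curvatureMatrix D Γ b c b d

/-- The covariant derivative `∇_a F_{bc}` of the curvature, the last two terms being due to the
form indices `b` and `c`. -/
def covDerivCurvature (a b c : ι) : Matrix ι ι A :=
  covDerivEnd D Γ a (curvatureMatrix D Γ b c)
    - ∑ m, Γ a m b • curvatureMatrix D Γ m c - ∑ m, Γ a m c • curvatureMatrix D Γ b m

theorem curvatureMatrix_swap (i j : ι) : curvatureMatrix D Γ j i = - curvatureMatrix D Γ i j := by
  unfold curvatureMatrix; abel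

variable {D Γ}

theorem covDerivCurvature_swap (a b c : ι) :
    covDerivCurvature D Γ a c b = - covDerivCurvature D Γ a b c := by
  unfold covDerivCurvature
  rw [curvatureMatrix_swap D Γ b c]
  simp only [fun m ↦ curvatureMatrix_swap D Γ b m, fun m ↦ curvatureMatrix_swap D Γ m c,
    smul_neg, Finset.sum_neg_distrib]
  have : covDerivEnd D Γ a (-curvatureMatrix D Γ b c)
      = - covDerivEnd D Γ a (curvatureMatrix D Γ b c) := by
    have h : (-curvatureMatrix D Γ b c).map (D a) = - (curvatureMatrix D Γ b c).map (D a) := by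
      ext; simp
    unfold covDerivEnd
    rw [h]; noncomm_ring
  rw [this]; abel

/-- The second Bianchi identity for the exterior covariant derivative of the curvature. It needs
no torsion-freeness. -/
theorem covDerivEnd_curvatureMatrix_cyclic (hD : ∀ i j f, D i (D j f) = D j (D i f)) (a b c : ι) :
    covDerivEnd D Γ a (curvatureMatrix D Γ b c) + covDerivEnd D Γ b (curvatureMatrix D Γ c a)
      + covDerivEnd D Γ c (curvatureMatrix D Γ a b) = 0 := by
  have h (i j : ι) (X : Matrix ι ι A) : (X.map (D j)).map (D i) = (X.map (D i)).map (D j) := by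
    ext; simp [hD i j]
  simp only [covDerivEnd, curvatureMatrix, map_derivation_add, map_derivation_sub,
    map_derivation_mul]
  rw [h a b, h a c, h b c]
  noncomm_ring

/-- The second Bianchi identity. -/
theorem covDerivCurvature_cyclic (hD : ∀ i j f, D i (D j f) = D j (D i f))
    (hΓ : ∀ i j l, Γ i l j = Γ j l i) (a b c : ι) :
    covDerivCurvature D Γ a b c + covDerivCurvature D Γ b c a + covDerivCurvature D Γ c a b
      = 0 := by
  have h (a b c : ι) : ∑ m, Γ a m c • curvatureMatrix D Γ b m
      = - ∑ m, Γ c m a • curvatureMatrix D Γ m b := by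
    rw [← Finset.sum_neg_distrib]
    refine Finset.sum_congr rfl fun m _ ↦ ?_
    rw [hΓ a c, curvatureMatrix_swap D Γ m b, smul_neg]
  have := covDerivEnd_curvatureMatrix_cyclic (Γ := Γ) hD a b c
  unfold covDerivCurvature
  rw [h a b c, h b c a, h c a b]
  rw [← this]; abel

/-- The first Bianchi identity. -/
theorem curvatureMatrix_cyclic (hΓ : ∀ i j l, Γ i l j = Γ j l i) (i j k l : ι) :
    curvatureMatrix D Γ i j l k + curvatureMatrix D Γ j k l i + curvatureMatrix D Γ k i l j
      = 0 := by
  simp only [curvatureMatrix, Matrix.sub_apply, Matrix.add_apply, map_apply, mul_apply]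
  simp only [hΓ k j, hΓ k i, hΓ j i]
  abel

/-- The trace of `∇_a F_{bc}` over `b` is the covariant derivative of the Ricci matrix. -/
theorem trace_covDerivCurvature (a c d : ι) :
    ∑ b, covDerivCurvature D Γ a b c b d = covDerivForm D Γ a (ricciMatrix D Γ) c d := by
  simp only [covDerivCurvature, covDerivEnd, covDerivForm, ricciMatrix, Matrix.sub_apply,
    Matrix.add_apply, map_apply, mul_apply, of_apply, transpose_apply, Matrix.sum_apply,
    Matrix.smul_apply, smul_eq_mul,
    Finset.sum_sub_distrib, Finset.sum_add_distrib, map_sum, Finset.mul_sum, Finset.sum_mul]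
  rw [Finset.sum_comm (f := fun b m ↦ Γ a m b * curvatureMatrix D Γ m c b d),
    Finset.sum_comm (f := fun b m ↦ Γ a m c * curvatureMatrix D Γ b m b d),
    Finset.sum_comm (f := fun b m ↦ curvatureMatrix D Γ b c b m * Γ a m d)]
  ring

variable {g P : Matrix ι ι A}

theorem map_derivation_inverse [DecidableEq ι] (hPg : P * g = 1) (hgP : g * P = 1)
    (hg : ∀ i, g.map (D i) = (Γ i)ᵀ * g + g * Γ i) (i : ι) :
    P.map (D i) = - (Γ i * P) - P * (Γ i)ᵀ := by
  have h := map_derivation_mul (D i) P g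
  rw [hPg, map_derivation_one, hg] at h
  calc P.map (D i) = (P.map (D i) * g) * P := by rw [Matrix.mul_assoc, hgP, Matrix.mul_one]
    _ = (- (P * ((Γ i)ᵀ * g + g * Γ i))) * P := by rw [← eq_neg_of_add_eq_zero_left h.symm]
    _ = - (P * (Γ i)ᵀ * (g * P)) - (P * g) * Γ i * P := by noncomm_ring
    _ = _ := by rw [hgP, hPg]; noncomm_ring

/-- Metric compatibility makes `F_{ij}` skew: the commutator of the second covariant derivatives
of the inverse metric `P` vanishes. -/
theorem curvatureMatrix_mul_skew (hD : ∀ i j f, D i (D j f) = D j (D i f)) (hP : Pᵀ = P)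
    (hdP : ∀ i, P.map (D i) = - (Γ i * P) - P * (Γ i)ᵀ) (i j : ι) :
    (curvatureMatrix D Γ i j * P)ᵀ = - (curvatureMatrix D Γ i j * P) := by
  have h : (P.map (D j)).map (D i) = (P.map (D i)).map (D j) := by
    ext; simp [hD i j]
  have hn (d : Derivation ℝ A A) (X : Matrix ι ι A) : (-X).map d = - X.map d := by
    ext; simp
  rw [hdP, hdP] at h
  have ht (d : Derivation ℝ A A) (X : Matrix ι ι A) : Xᵀ.map d = (X.map d)ᵀ := rfl
  simp only [map_derivation_sub, map_derivation_mul, hn, hdP, ht] at h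
  rw [← sub_eq_zero] at h
  rw [transpose_mul, hP, ← sub_eq_zero, ← neg_eq_zero, ← h]
  simp only [curvatureMatrix, transpose_sub, transpose_add, transpose_mul]
  noncomm_ring

theorem covDerivEnd_mul_skew (hdP : ∀ i, P.map (D i) = - (Γ i * P) - P * (Γ i)ᵀ) (a : ι)
    {X : Matrix ι ι A} (hX : (X * P)ᵀ = - (X * P)) :
    (covDerivEnd D Γ a X * P)ᵀ = - (covDerivEnd D Γ a X * P) := by
  have h := map_derivation_mul (D a) X P
  have h' : ((X * P).map (D a))ᵀ = - (X * P).map (D a) := by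
    rw [← transpose_map, hX]; ext; simp
  have e : covDerivEnd D Γ a X * P
      = (X * P).map (D a) + Γ a * (X * P) + (X * P) * (Γ a)ᵀ := by
    rw [h, hdP]; unfold covDerivEnd; noncomm_ring
  rw [e, transpose_add, transpose_add, h', transpose_mul, transpose_mul (X * P),
    transpose_transpose, hX]
  noncomm_ring

theorem covDerivCurvature_mul_skew (hD : ∀ i j f, D i (D j f) = D j (D i f)) (hP : Pᵀ = P)
    (hdP : ∀ i, P.map (D i) = - (Γ i * P) - P * (Γ i)ᵀ) (a b c : ι) :
    (covDerivCurvature D Γ a b c * P)ᵀ = - (covDerivCurvature D Γ a b c * P) := by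
  have hF := curvatureMatrix_mul_skew hD hP hdP
  simp only [covDerivCurvature, Matrix.sub_mul, transpose_sub, Matrix.sum_mul, transpose_sum,
    Matrix.smul_mul, transpose_smul, hF, covDerivEnd_mul_skew hdP a (hF b c), smul_neg,
    Finset.sum_neg_distrib]
  abel

/-- As `F_{ij} P` is skew and `g` is symmetric, `tr F_{ij} = tr (F_{ij} P g)` is its own
negative. -/
theorem trace_curvatureMatrix [DecidableEq ι] (hD : ∀ i j f, D i (D j f) = D j (D i f))
    (hP : Pᵀ = P) (hPg : P * g = 1) (hgs : gᵀ = g)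
    (hdP : ∀ i, P.map (D i) = - (Γ i * P) - P * (Γ i)ᵀ) (i j : ι) :
    trace (curvatureMatrix D Γ i j) = 0 := by
  have hF := curvatureMatrix_mul_skew hD hP hdP i j
  set F := curvatureMatrix D Γ i j
  have h : trace F = - trace F := by
    calc trace F = trace (F * P * g) := by rw [Matrix.mul_assoc, hPg, Matrix.mul_one]
      _ = trace ((F * P * g)ᵀ) := (trace_transpose _).symm
      _ = trace (- (F * P * g)) := by
        rw [transpose_mul, hF, hgs, trace_mul_comm, Matrix.neg_mul]
      _ = - trace F := by rw [Matrix.mul_assoc, hPg, Matrix.mul_one, trace_neg]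
  have h2 : (2 : ℝ) • trace F = 0 := by
    rw [two_smul]; nth_rw 1 [h]; exact neg_add_cancel _
  simpa using congrArg ((2 : ℝ)⁻¹ • ·) h2

/-- The Ricci tensor is symmetric: contract the first Bianchi identity and use that `F_{ij}` is
trace-free. -/
theorem ricciMatrix_transpose [DecidableEq ι] (hD : ∀ i j f, D i (D j f) = D j (D i f))
    (hΓ : ∀ i j l, Γ i l j = Γ j l i) (hP : Pᵀ = P) (hPg : P * g = 1) (hgs : gᵀ = g)
    (hdP : ∀ i, P.map (D i) = - (Γ i * P) - P * (Γ i)ᵀ) :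
    (ricciMatrix D Γ)ᵀ = ricciMatrix D Γ := by
  ext c d
  simp only [ricciMatrix, transpose_apply, of_apply]
  have h := Finset.sum_congr rfl fun b (_ : b ∈ Finset.univ) ↦
    curvatureMatrix_cyclic (D := D) hΓ b c d b
  have ht : ∑ b, curvatureMatrix D Γ c d b b = 0 := trace_curvatureMatrix hD hP hPg hgs hdP c d
  simp only [Finset.sum_add_distrib, ht, Finset.sum_const_zero, add_zero,
    fun b ↦ curvatureMatrix_swap D Γ b d, Matrix.neg_apply, Finset.sum_neg_distrib] at h
  rw [← sub_eq_add_neg, sub_eq_zero] at h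
  exact h.symm

theorem derivation_trace_mul (hdP : ∀ i, P.map (D i) = - (Γ i * P) - P * (Γ i)ᵀ) (a : ι)
    (S : Matrix ι ι A) : D a (trace (P * S)) = trace (P * covDerivForm D Γ a S) := by
  have h : D a (trace (P * S)) = trace ((P * S).map (D a)) := by
    simp [trace, map_sum]
  rw [h, map_derivation_mul, hdP]
  have e : (-(Γ a * P) - P * (Γ a)ᵀ) * S + P * S.map (D a)
      = P * covDerivForm D Γ a S + (P * S * Γ a - Γ a * (P * S)) := by
    unfold covDerivForm; noncomm_ring
  rw [e, trace_add, trace_sub, trace_mul_comm (Γ a), sub_self, add_zero]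

/-- Raising an index commutes with covariant differentiation. -/
theorem covDerivEnd_mul (hdP : ∀ i, P.map (D i) = - (Γ i * P) - P * (Γ i)ᵀ) (a : ι)
    (S : Matrix ι ι A) : covDerivEnd D Γ a (P * S) = P * covDerivForm D Γ a S := by
  unfold covDerivEnd covDerivForm
  rw [map_derivation_mul, hdP]; noncomm_ring

theorem covDerivForm_transpose (a : ι) {S : Matrix ι ι A} (hS : Sᵀ = S) :
    (covDerivForm D Γ a S)ᵀ = covDerivForm D Γ a S := by
  unfold covDerivForm
  rw [transpose_sub, transpose_sub, ← transpose_map, transpose_mul, transpose_mul, hS,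
    transpose_transpose]
  abel

omit [Algebra ℝ A] in
/-- Contracting `T_{bc}` over its indices and the metric in two ways gives opposite results if
all matrices `T_{bc} P` are skew. -/
theorem sum_contraction_exchange (hP : Pᵀ = P) {T : ι → ι → Matrix ι ι A}
    (hT : ∀ b c, (T b c * P)ᵀ = - (T b c * P)) :
    ∑ c, ∑ d, P d c * ∑ b, T b c b d = - ∑ b, ∑ d, P b d * ∑ c, T b c c d := by
  have e (b c : ι) : ∑ d, P d c * T b c b d = - ∑ d, P b d * T b c c d := by
    have h := congrFun₂ (hT b c) c b
    simp only [transpose_apply, mul_apply, Matrix.neg_apply] at h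
    simp only [fun d ↦ mul_comm (P d c), h]
    congr 1
    refine Finset.sum_congr rfl fun d _ ↦ ?_
    rw [mul_comm, show P d b = P b d from congrFun₂ hP b d]
  calc ∑ c, ∑ d, P d c * ∑ b, T b c b d
      = ∑ c, ∑ b, ∑ d, P d c * T b c b d := by
        refine Finset.sum_congr rfl fun c _ ↦ ?_
        rw [Finset.sum_comm]
        exact Finset.sum_congr rfl fun d _ ↦ Finset.mul_sum ..
    _ = - ∑ b, ∑ c, ∑ d, P b d * T b c c d := by
        rw [Finset.sum_comm]
        simp only [e, Finset.sum_neg_distrib]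
    _ = _ := by
        congr 1
        refine Finset.sum_congr rfl fun b _ ↦ ?_
        rw [Finset.sum_comm]
        exact Finset.sum_congr rfl fun d _ ↦ (Finset.mul_sum ..).symm

/-- The twice contracted second Bianchi identity `∂_a R = 2 ∇^b R_{ba}`. -/
theorem derivation_trace_ricci [DecidableEq ι] (hD : ∀ i j f, D i (D j f) = D j (D i f))
    (hΓ : ∀ i j l, Γ i l j = Γ j l i) (hP : Pᵀ = P) (hPg : P * g = 1) (hgs : gᵀ = g)
    (hdP : ∀ i, P.map (D i) = - (Γ i * P) - P * (Γ i)ᵀ) (a : ι) :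
    D a (trace (P * ricciMatrix D Γ))
      = 2 * ∑ b, covDerivEnd D Γ b (P * ricciMatrix D Γ) b a := by
  have hS := ricciMatrix_transpose hD hΓ hP hPg hgs hdP
  have hsym (a c d : ι) : covDerivForm D Γ a (ricciMatrix D Γ) c d
      = covDerivForm D Γ a (ricciMatrix D Γ) d c :=
    congrFun₂ (covDerivForm_transpose a hS) d c
  have hPs (c d : ι) : P c d = P d c := congrFun₂ hP d c
  have hdiv : ∑ b, covDerivEnd D Γ b (P * ricciMatrix D Γ) b a
      = ∑ b, ∑ c, P b c * covDerivForm D Γ b (ricciMatrix D Γ) c a := by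
    simp only [covDerivEnd_mul hdP, mul_apply]
  have h1 : ∑ c, ∑ d, P d c * ∑ b, covDerivCurvature D Γ a b c b d
      = D a (trace (P * ricciMatrix D Γ)) := by
    rw [derivation_trace_mul hdP]
    simp only [trace_covDerivCurvature, trace, diag_apply, mul_apply]
    exact Finset.sum_comm
  -- Antisymmetry of `F_{ab}` in its form indices.
  have h3 : ∑ c, ∑ d, P d c * ∑ b, covDerivCurvature D Γ c a b b d
      = - ∑ b, ∑ c, P b c * covDerivForm D Γ b (ricciMatrix D Γ) c a := by
    simp only [fun c b ↦ covDerivCurvature_swap (D := D) (Γ := Γ) c b a, Matrix.neg_apply,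
      Finset.sum_neg_distrib, trace_covDerivCurvature, mul_neg]
    simp only [fun c d ↦ hsym c a d, fun c d ↦ hPs d c]
  -- The traced index is `b`, the direction of differentiation; skewness moves the trace to `c`.
  have h2 : ∑ c, ∑ d, P d c * ∑ b, covDerivCurvature D Γ b c a b d
      = - ∑ b, ∑ c, P b c * covDerivForm D Γ b (ricciMatrix D Γ) c a := by
    rw [sum_contraction_exchange hP fun b c ↦ covDerivCurvature_mul_skew hD hP hdP b c a]
    simp only [trace_covDerivCurvature, fun b d ↦ hsym b a d]
  have hsum : ∑ c, ∑ d, P d c * ∑ b, (covDerivCurvature D Γ a b c + covDerivCurvature D Γ b c a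
      + covDerivCurvature D Γ c a b) b d = 0 := by
    simp only [covDerivCurvature_cyclic hD hΓ, Matrix.zero_apply, Finset.sum_const_zero, mul_zero]
  simp only [Matrix.add_apply, Finset.sum_add_distrib, mul_add, h1, h2, h3] at hsum
  rw [hdiv]
  linear_combination hsum

/-- The mixed Hilbert–Einstein–Cartan tensor `P S - ½ R` is divergence free. -/
theorem divergence_einstein [DecidableEq ι] (hD : ∀ i j f, D i (D j f) = D j (D i f))
    (hΓ : ∀ i j l, Γ i l j = Γ j l i) (hgs : gᵀ = g) (hPg : P * g = 1)
    (hg : ∀ i, g.map (D i) = (Γ i)ᵀ * g + g * Γ i) (j : ι) :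
    ∑ i, covDerivEnd D Γ i
      (P * (ricciMatrix D Γ - (1 / 2 : ℝ) • trace (P * ricciMatrix D Γ) • g)) i j = 0 := by
  have hgP : g * P = 1 := mul_eq_one_comm.mp hPg
  have hP : Pᵀ = P := by
    have h : Pᵀ * g = 1 := by
      rw [← transpose_one, ← hgP, transpose_mul, hgs]
    calc Pᵀ = Pᵀ * g * P := by rw [Matrix.mul_assoc, hgP, Matrix.mul_one]
      _ = P := by rw [h, Matrix.one_mul]
  have hdP := map_derivation_inverse hPg hgP hg
  have key := derivation_trace_ricci hD hΓ hP hPg hgs hdP j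
  set S := ricciMatrix D Γ
  set R := trace (P * S)
  -- The scalar multiple `R • 1` commutes with `Γ i`, so its covariant derivative is `D i R • 1`.
  have e (i : ι) : covDerivEnd D Γ i (P * (S - (1 / 2 : ℝ) • R • g)) i j
      = covDerivEnd D Γ i (P * S) i j - (1 / 2 : ℝ) • (D i R * (1 : Matrix ι ι A) i j) := by
    have e1 : P * (S - (1 / 2 : ℝ) • R • g) = P * S - (1 / 2 : ℝ) • R • (1 : Matrix ι ι A) := by
      rw [Matrix.mul_sub, Matrix.mul_smul, Matrix.mul_smul, hPg]
    have e2 : ((1 / 2 : ℝ) • R • (1 : Matrix ι ι A)).map (D i)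
        = (1 / 2 : ℝ) • D i R • (1 : Matrix ι ι A) := by
      ext k l
      by_cases h : k = l <;> simp [h]
    rw [e1]
    unfold covDerivEnd
    rw [map_derivation_sub, e2]
    simp only [Matrix.mul_sub, Matrix.sub_mul, Matrix.mul_smul, Matrix.smul_mul, Matrix.mul_one,
      Matrix.one_mul, Matrix.sub_apply, Matrix.add_apply, Matrix.smul_apply, smul_eq_mul]
    ring
  simp only [e, Finset.sum_sub_distrib, ← Finset.smul_sum, one_apply, mul_ite, mul_one, mul_zero,
    Finset.sum_ite_eq', Finset.mem_univ, if_true, key]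
  rw [two_mul, ← two_smul ℝ, smul_smul]
  norm_num

end PseudoRiemannian.Algebraic

namespace PseudoRiemannian

variable {n : ℕ} {M : Type*} [TopologicalSpace M]
  [ChartedSpace (EuclideanSpace ℝ (Fin n)) M]
  {φ : OpenPartialHomeomorph M (EuclideanSpace ℝ (Fin n))} {x : M}

/-! ### Coordinate vector fields -/

theorem chart_mdifferentiable (hφ : φ ∈ IsManifold.maximalAtlas (𝓡 n) ∞ M) :
    φ.MDifferentiable (𝓡 n) (𝓡 n) :=
  ⟨(contMDiffOn_of_mem_maximalAtlas hφ).mdifferentiableOn (by simp),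
    (contMDiffOn_symm_of_mem_maximalAtlas hφ).mdifferentiableOn (by simp)⟩

theorem isInvertible_mfderiv_chart (hφ : φ ∈ IsManifold.maximalAtlas (𝓡 n) ∞ M)
    (hx : x ∈ φ.source) : (mfderiv (𝓡 n) (𝓡 n) φ x).IsInvertible :=
  ⟨(chart_mdifferentiable hφ).mfderiv hx, rfl⟩

theorem mfderiv_chart_coordField (hφ : φ ∈ IsManifold.maximalAtlas (𝓡 n) ∞ M)
    (hx : x ∈ φ.source) (i : Fin n) :
    mfderiv (𝓡 n) (𝓡 n) φ x (coordField φ i x)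
      = (EuclideanSpace.single i (1 : ℝ) : EuclideanSpace ℝ (Fin n)) :=
  (isInvertible_mfderiv_chart hφ hx).self_apply_inverse _

theorem coordForm_apply (hφ : φ ∈ IsManifold.maximalAtlas (𝓡 n) ∞ M)
    (hx : x ∈ φ.source) (k : Fin n) (v : TangentSpace (𝓡 n) x) :
    coordForm φ k x v = WithLp.ofLp (p := 2) (V := Fin n → ℝ) (mfderiv (𝓡 n) (𝓡 n) φ x v) k := by
  have h := mvfderiv_comp_apply (I := 𝓡 n) (I' := 𝓡 n)
    (g := fun u : EuclideanSpace ℝ (Fin n) ↦ u k) (f := φ) x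
    (EuclideanSpace.proj (𝕜 := ℝ) k).differentiableAt.mdifferentiableAt
    ((chart_mdifferentiable hφ).mdifferentiableAt hx) v
  refine h.trans ?_
  have h2 : mfderiv (𝓡 n) 𝓘(ℝ, ℝ) (fun u : EuclideanSpace ℝ (Fin n) ↦ u k) (φ x)
      = (EuclideanSpace.proj (𝕜 := ℝ) k : EuclideanSpace ℝ (Fin n) →L[ℝ] ℝ) := by
    rw [mfderiv_eq_fderiv]
    exact (EuclideanSpace.proj (𝕜 := ℝ) k).fderiv
  unfold mvfderiv
  rw [h2]; rfl

theorem coordForm_coordField (hφ : φ ∈ IsManifold.maximalAtlas (𝓡 n) ∞ M)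
    (hx : x ∈ φ.source) (k i : Fin n) :
    coordForm φ k x (coordField φ i x) = if k = i then 1 else 0 := by
  rw [coordForm_apply hφ hx, mfderiv_chart_coordField hφ hx]
  simp

theorem sum_coordForm_smul_coordField (hφ : φ ∈ IsManifold.maximalAtlas (𝓡 n) ∞ M)
    (hx : x ∈ φ.source) (v : TangentSpace (𝓡 n) x) :
    ∑ k, coordForm φ k x v • coordField φ k x = v := by
  apply (chart_mdifferentiable hφ).mfderiv_injective hx
  rw [map_sum]
  simp only [map_smul, mfderiv_chart_coordField hφ hx, coordForm_apply hφ hx]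
  have h (w : EuclideanSpace ℝ (Fin n)) : ∑ k, w k • EuclideanSpace.single k (1 : ℝ) = w := by
    simpa using (EuclideanSpace.basisFun (Fin n) ℝ).sum_repr w
  exact h _

/-- The partial derivative is the ordinary one of the coordinate expression. -/
theorem partialDeriv_eq_fderiv (hφ : φ ∈ IsManifold.maximalAtlas (𝓡 n) ∞ M)
    (hx : x ∈ φ.source) {f : M → ℝ} (hf : MDifferentiableAt (𝓡 n) 𝓘(ℝ, ℝ) f x) (i : Fin n) :
    partialDeriv φ i f x
      = fderiv ℝ (f ∘ φ.symm) (φ x) (EuclideanSpace.single i (1 : ℝ)) := by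
  have hsymm := (chart_mdifferentiable hφ).mdifferentiableAt_symm (φ.map_source hx)
  have hd : MDifferentiableAt (𝓡 n) 𝓘(ℝ, ℝ) (f ∘ φ.symm) (φ x) :=
    MDifferentiableAt.comp_of_eq _ hf hsymm (φ.left_inv hx)
  have h := mvfderiv_comp_apply (I := 𝓡 n) (I' := 𝓡 n) (g := f ∘ φ.symm) (f := φ) x hd
    ((chart_mdifferentiable hφ).mdifferentiableAt hx) (coordField φ i x)
  have he : f =ᶠ[nhds x] (f ∘ φ.symm) ∘ φ := by
    filter_upwards [φ.open_source.mem_nhds hx] with y hy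
    simp [φ.left_inv hy]
  have he' : mvfderiv (𝓡 n) f x = mvfderiv (𝓡 n) ((f ∘ φ.symm) ∘ φ) x := by
    unfold mvfderiv
    ext v
    simp only [he.mfderiv_eq]
    rfl
  unfold partialDeriv
  rw [he', h, mfderiv_chart_coordField hφ hx]
  unfold mvfderiv
  rw [mfderiv_eq_fderiv]
  rfl

/-- The constant vector field `eᵢ` on the model space. -/
def constField (i : Fin n) (u : EuclideanSpace ℝ (Fin n)) : TangentSpace (𝓡 n) u :=
  (EuclideanSpace.single i (1 : ℝ) : EuclideanSpace ℝ (Fin n))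

theorem contMDiffAt_constField (i : Fin n) (u : EuclideanSpace ℝ (Fin n)) :
    ContMDiffAt (𝓡 n) (𝓡 n).tangent ∞ (T% (constField (n := n) i)) u := by
  rw [← contMDiffWithinAt_univ, contMDiffWithinAt_vectorSpace_iff_contDiffWithinAt]
  exact contDiffWithinAt_const

variable [IsManifold (𝓡 n) ∞ M]

theorem contMDiffOn_coordField (hφ : φ ∈ IsManifold.maximalAtlas (𝓡 n) ∞ M) (i : Fin n) :
    ContMDiffOn (𝓡 n) (𝓡 n).tangent ∞ (T% (coordField φ i)) φ.source := by
  intro x hx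
  refine ContMDiffAt.contMDiffWithinAt ?_
  exact ContMDiffAt.mpullback_vectorField_preimage (contMDiffAt_constField i (φ x))
    (contMDiffAt_of_mem_maximalAtlas hφ hx) (isInvertible_mfderiv_chart hφ hx) (by simp)

theorem mdifferentiableAt_coordField (hφ : φ ∈ IsManifold.maximalAtlas (𝓡 n) ∞ M)
    (hx : x ∈ φ.source) (i : Fin n) :
    MDifferentiableAt (𝓡 n) (𝓡 n).tangent (T% (coordField φ i)) x :=
  ((contMDiffOn_coordField hφ i).contMDiffAt (φ.open_source.mem_nhds hx)).mdifferentiableAt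
    (by simp)

theorem mlieBracket_coordField (hφ : φ ∈ IsManifold.maximalAtlas (𝓡 n) ∞ M)
    (hx : x ∈ φ.source) (i j : Fin n) :
    VectorField.mlieBracket (𝓡 n) (coordField φ i) (coordField φ j) x = 0 := by
  have hc (i : Fin n) := (contMDiffAt_constField i (φ x)).mdifferentiableAt (by simp)
  have : IsManifold (𝓡 n) (minSmoothness ℝ 2) M := by
    rw [minSmoothness_of_isRCLikeNormedField]
    exact IsManifold.of_le (n := ∞) (by exact ENat.LEInfty.out)
  have h := VectorField.mpullback_mlieBracket (I := 𝓡 n) (I' := 𝓡 n) (n := ∞) (hc i) (hc j)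
    (contMDiffAt_of_mem_maximalAtlas hφ hx)
    (by rw [minSmoothness_of_isRCLikeNormedField]; exact ENat.LEInfty.out)
  refine h.symm.trans ?_
  rw [VectorField.mpullback_apply, ← VectorField.mlieBracketWithin_univ,
    VectorField.mlieBracketWithin_eq_lieBracketWithin]
  have hd (i : Fin n) : fderivWithin ℝ (constField (n := n) i) Set.univ (φ x) = 0 :=
    fderivWithin_const_apply _
  have h0 : VectorField.lieBracketWithin ℝ (constField (n := n) i) (constField j) Set.univ (φ x)
      = (0 : EuclideanSpace ℝ (Fin n)) := by
    simp only [VectorField.lieBracketWithin, hd]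
    exact sub_self (0 : EuclideanSpace ℝ (Fin n))
  rw [h0]
  exact map_zero _

end PseudoRiemannian

namespace PseudoRiemannian

variable {n : ℕ} {M : Type*} [TopologicalSpace M]
  [ChartedSpace (EuclideanSpace ℝ (Fin n)) M]
  {φ : OpenPartialHomeomorph M (EuclideanSpace ℝ (Fin n))} {x : M}

/-! ### The ring of smooth functions on the chart domain -/

variable (φ) in
/-- The algebra of the functions that are smooth on the domain of the chart `φ`. Elements are
functions on all of `M`, with arbitrary values off the domain. -/
def smoothAlgebra : Subalgebra ℝ (M → ℝ) where
  carrier := {f | ContMDiffOn (𝓡 n) 𝓘(ℝ, ℝ) ∞ f φ.source}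
  mul_mem' hf hg := hf.mul hg
  add_mem' hf hg := hf.add hg
  algebraMap_mem' _ := contMDiffOn_const

theorem mdifferentiableAt_of_mem_smoothAlgebra (hx : x ∈ φ.source) (f : smoothAlgebra φ) :
    MDifferentiableAt (𝓡 n) 𝓘(ℝ, ℝ) (f : M → ℝ) x :=
  (ContMDiffOn.contMDiffAt f.2 (φ.open_source.mem_nhds hx)).mdifferentiableAt (by simp)

theorem contDiffOn_comp_chart_symm (hφ : φ ∈ IsManifold.maximalAtlas (𝓡 n) ∞ M)
    (f : smoothAlgebra φ) : ContDiffOn ℝ ∞ ((f : M → ℝ) ∘ φ.symm) φ.target :=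
  contMDiffOn_iff_contDiffOn.mp
    (ContMDiffOn.comp f.2 (contMDiffOn_symm_of_mem_maximalAtlas hφ) φ.mapsTo_symm)

theorem contMDiffOn_partialDeriv (hφ : φ ∈ IsManifold.maximalAtlas (𝓡 n) ∞ M)
    (f : smoothAlgebra φ) (i : Fin n) :
    ContMDiffOn (𝓡 n) 𝓘(ℝ, ℝ) ∞ (partialDeriv φ i f) φ.source := by
  have h1 : ContDiffOn ℝ ∞ (fun u ↦ fderiv ℝ ((f : M → ℝ) ∘ φ.symm) u
      (EuclideanSpace.single i (1 : ℝ))) φ.target :=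
    ((contDiffOn_comp_chart_symm hφ f).fderiv_of_isOpen φ.open_target (by simp)).clm_apply
      contDiffOn_const
  refine (h1.contMDiffOn.comp (contMDiffOn_of_mem_maximalAtlas hφ) φ.mapsTo).congr fun y hy ↦ ?_
  exact partialDeriv_eq_fderiv hφ hy (mdifferentiableAt_of_mem_smoothAlgebra hy f) i

theorem partialDeriv_congr {f f' : M → ℝ} (hx : x ∈ φ.source) (h : Set.EqOn f f' φ.source)
    (i : Fin n) : partialDeriv φ i f x = partialDeriv φ i f' x := by
  have he : f =ᶠ[nhds x] f' := by
    filter_upwards [φ.open_source.mem_nhds hx] with y hy using h hy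
  unfold partialDeriv mvfderiv
  rw [ContinuousLinearMap.comp_apply, ContinuousLinearMap.comp_apply, he.mfderiv_eq]
  rfl

/-- The partial derivative `∂/∂xⁱ` as a derivation of the algebra of smooth functions on the chart
domain; it is given the value `0` off the domain, so that the Leibniz rule holds everywhere. -/
def coordDerivation (hφ : φ ∈ IsManifold.maximalAtlas (𝓡 n) ∞ M) (i : Fin n) :
    Derivation ℝ (smoothAlgebra φ) (smoothAlgebra φ) :=
  Derivation.mk'
    { toFun := fun f ↦ ⟨φ.source.indicator (partialDeriv φ i f),
        (contMDiffOn_partialDeriv hφ f i).congr fun _ hy ↦ Set.indicator_of_mem hy _⟩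
      map_add' := fun f f' ↦ by
        ext y
        by_cases hy : y ∈ φ.source
        · have h := mvfderiv_add (mdifferentiableAt_of_mem_smoothAlgebra hy f)
            (mdifferentiableAt_of_mem_smoothAlgebra hy f')
          simpa [hy, partialDeriv] using congrArg (fun L ↦ L (coordField φ i y)) h
        · simp [hy]
      map_smul' := fun c f ↦ by
        ext y
        by_cases hy : y ∈ φ.source
        · have h := mvfderiv_smul (mdifferentiableAt_const (c := c))
            (mdifferentiableAt_of_mem_smoothAlgebra hy f)
          have h' := congrArg (fun L ↦ L (coordField φ i y)) h
          simpa [hy, partialDeriv, mvfderiv_const] using! h'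
        · simp [hy] }
    fun f f' ↦ by
      ext y
      by_cases hy : y ∈ φ.source
      · have h := mvfderiv_mul (mdifferentiableAt_of_mem_smoothAlgebra hy f)
          (mdifferentiableAt_of_mem_smoothAlgebra hy f')
        simpa [hy, partialDeriv] using congrArg (fun L ↦ L (coordField φ i y)) h
      · simp [hy]

theorem coordDerivation_apply (hφ : φ ∈ IsManifold.maximalAtlas (𝓡 n) ∞ M) (i : Fin n)
    (f : smoothAlgebra φ) (hx : x ∈ φ.source) :
    (coordDerivation hφ i f : M → ℝ) x = partialDeriv φ i f x :=
  Set.indicator_of_mem hx _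

theorem coordDerivation_apply_of_notMem (hφ : φ ∈ IsManifold.maximalAtlas (𝓡 n) ∞ M) (i : Fin n)
    (f : smoothAlgebra φ) (hx : x ∉ φ.source) :
    (coordDerivation hφ i f : M → ℝ) x = 0 :=
  Set.indicator_of_notMem hx _

/-- Partial derivatives commute, by the symmetry of the second derivative. -/
theorem coordDerivation_comm (hφ : φ ∈ IsManifold.maximalAtlas (𝓡 n) ∞ M) (i j : Fin n)
    (f : smoothAlgebra φ) :
    coordDerivation hφ i (coordDerivation hφ j f)
      = coordDerivation hφ j (coordDerivation hφ i f) := by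
  ext x
  by_cases hx : x ∈ φ.source
  · have hF := (contDiffOn_comp_chart_symm hφ f).contDiffAt
      (φ.open_target.mem_nhds (φ.map_source hx))
    have key (i j : Fin n) : (coordDerivation hφ i (coordDerivation hφ j f) : M → ℝ) x
        = fderiv ℝ (fderiv ℝ ((f : M → ℝ) ∘ φ.symm)) (φ x)
          (EuclideanSpace.single i (1 : ℝ)) (EuclideanSpace.single j (1 : ℝ)) := by
      rw [coordDerivation_apply hφ i _ hx,
        partialDeriv_eq_fderiv hφ hx (mdifferentiableAt_of_mem_smoothAlgebra hx _)]
      have he : (coordDerivation hφ j f : M → ℝ) ∘ φ.symm =ᶠ[nhds (φ x)]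
          fun u ↦ fderiv ℝ ((f : M → ℝ) ∘ φ.symm) u (EuclideanSpace.single j (1 : ℝ)) := by
        filter_upwards [φ.open_target.mem_nhds (φ.map_source hx)] with u hu
        have hu' := φ.map_target hu
        rw [Function.comp_apply, coordDerivation_apply hφ j _ hu',
          partialDeriv_eq_fderiv hφ hu' (mdifferentiableAt_of_mem_smoothAlgebra hu' _),
          φ.right_inv hu]
      rw [he.fderiv_eq]
      have hd : DifferentiableAt ℝ (fderiv ℝ ((f : M → ℝ) ∘ φ.symm)) (φ x) :=
        (hF.fderiv_right (m := 1)
          (by rw [one_add_one_eq_two]; exact ENat.LEInfty.out)).differentiableAt (by simp)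
      rw [fderiv_clm_apply hd (differentiableAt_const _)]
      simp
    rw [key, key]
    refine (hF.isSymmSndFDerivAt ?_).eq _ _
    rw [minSmoothness_of_isRCLikeNormedField]
    exact ENat.LEInfty.out
  · rw [coordDerivation_apply_of_notMem hφ _ _ hx, coordDerivation_apply_of_notMem hφ _ _ hx]

theorem isUnit_of_forall_ne_zero {f : smoothAlgebra φ} (hf : ∀ y, (f : M → ℝ) y ≠ 0) :
    IsUnit f := by
  refine IsUnit.of_mul_eq_one ⟨fun y ↦ ((f : M → ℝ) y)⁻¹, ?_⟩ ?_
  · exact ContMDiffOn.inv₀ f.2 fun y _ ↦ hf y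
  · ext y
    exact mul_inv_cancel₀ (hf y)

variable (φ) in
/-- Evaluation at the point `x`. -/
def evalAt (x : M) : smoothAlgebra φ →+* ℝ :=
  (Pi.evalRingHom (fun _ : M ↦ ℝ) x).comp (smoothAlgebra φ).val.toRingHom

theorem evalAt_apply (x : M) (f : smoothAlgebra φ) : evalAt φ x f = (f : M → ℝ) x := rfl

end PseudoRiemannian

namespace PseudoRiemannian

variable {n : ℕ} {M : Type*} [TopologicalSpace M]
  [ChartedSpace (EuclideanSpace ℝ (Fin n)) M] [IsManifold (𝓡 n) ∞ M]
  {φ : OpenPartialHomeomorph M (EuclideanSpace ℝ (Fin n))} {x : M}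
  {g : Metric n M} {nabla : Connection n M}

/-! ### The metric in a chart -/

theorem contMDiffOn_metricMatrix (hφ : φ ∈ IsManifold.maximalAtlas (𝓡 n) ∞ M) (g : Metric n M)
    (i j : Fin n) :
    ContMDiffOn (𝓡 n) 𝓘(ℝ, ℝ) ∞ (fun y ↦ metricMatrix φ g y i j) φ.source := by
  have h := ContMDiffOn.clm_bundle_apply₂ (F₁ := EuclideanSpace ℝ (Fin n))
    (F₂ := EuclideanSpace ℝ (Fin n)) (F₃ := ℝ) (E₃ := Bundle.Trivial M ℝ)
    (E₁ := fun y : M ↦ TangentSpace (𝓡 n) y) (E₂ := fun y : M ↦ TangentSpace (𝓡 n) y)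
    (b := id) g.contMDiff.contMDiffOn
    (contMDiffOn_coordField hφ i) (contMDiffOn_coordField hφ j)
  intro y hy
  have hy' := h y hy
  simp only [Bundle.contMDiffWithinAt_totalSpace] at hy'
  exact hy'.2

theorem metricMatrix_transpose (g : Metric n M) (x : M) :
    (metricMatrix φ g x).transpose = metricMatrix φ g x := by
  ext i j
  exact g.symm x _ _

/-- A null vector of the matrix gives a tangent vector orthogonal to all coordinate fields, which
is zero by nondegeneracy. -/
theorem isUnit_det_metricMatrix (hφ : φ ∈ IsManifold.maximalAtlas (𝓡 n) ∞ M)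
    (hx : x ∈ φ.source) (g : Metric n M) : IsUnit (metricMatrix φ g x).det := by
  rw [isUnit_iff_ne_zero, Ne, ← Matrix.exists_mulVec_eq_zero_iff]
  rintro ⟨w, hw, h⟩
  have hv : ∑ j, w j • coordField φ j x = 0 := by
    refine g.nondegenerate x _ fun v ↦ ?_
    rw [← sum_coordForm_smul_coordField hφ hx v]
    simp only [map_sum, map_smul, sum_apply, smul_apply]
    refine Finset.sum_eq_zero fun k _ ↦ ?_
    have hk : ∑ j, metricMatrix φ g x k j * w j = 0 := congrFun h k
    have : ∑ j, w j • g.inner x (coordField φ j x) (coordField φ k x) = 0 := by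
      rw [← hk]
      refine Finset.sum_congr rfl fun j _ ↦ ?_
      rw [g.symm x, smul_eq_mul, mul_comm]
      rfl
    rw [this, smul_zero]
  refine hw (funext fun k ↦ ?_)
  have h2 := congrArg (coordForm φ k x) hv
  simpa [map_sum, coordForm_coordField hφ hx] using h2

/-! ### The Levi-Civita connection in a chart -/

theorem nabla_coordField (hφ : φ ∈ IsManifold.maximalAtlas (𝓡 n) ∞ M) (hx : x ∈ φ.source)
    (i j : Fin n) :
    nabla (coordField φ j) x (coordField φ i x)
      = ∑ l, christoffel φ nabla l i j x • coordField φ l x :=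
  (sum_coordForm_smul_coordField hφ hx _).symm

theorem christoffel_symm (hφ : φ ∈ IsManifold.maximalAtlas (𝓡 n) ∞ M) (hx : x ∈ φ.source)
    (hn : IsLeviCivita g nabla) (l i j : Fin n) :
    christoffel φ nabla l i j x = christoffel φ nabla l j i x := by
  have h := hn.symmetric x _ _ (mdifferentiableAt_coordField hφ hx i)
    (mdifferentiableAt_coordField hφ hx j)
  rw [mlieBracket_coordField hφ hx, sub_eq_zero] at h
  unfold christoffel
  rw [h]

theorem partialDeriv_metricMatrix (hφ : φ ∈ IsManifold.maximalAtlas (𝓡 n) ∞ M)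
    (hx : x ∈ φ.source) (hn : IsLeviCivita g nabla) (k i j : Fin n) :
    partialDeriv φ k (fun y ↦ metricMatrix φ g y i j) x
      = ∑ l, christoffel φ nabla l k i x * metricMatrix φ g x l j
        + ∑ l, metricMatrix φ g x i l * christoffel φ nabla l k j x := by
  have h := hn.compatible x (coordField φ k) _ _ (mdifferentiableAt_coordField hφ hx i)
    (mdifferentiableAt_coordField hφ hx j)
  refine h.trans ?_
  rw [nabla_coordField hφ hx, nabla_coordField hφ hx]
  simp only [map_sum, map_smul, sum_apply, smul_apply,
    smul_eq_mul]
  congr 1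
  exact Finset.sum_congr rfl fun l _ ↦ mul_comm _ _

/-- The Koszul formula for the Christoffel symbols of the first kind. -/
theorem koszul (hφ : φ ∈ IsManifold.maximalAtlas (𝓡 n) ∞ M)
    (hx : x ∈ φ.source) (hn : IsLeviCivita g nabla) (i j m : Fin n) :
    ∑ l, metricMatrix φ g x m l * christoffel φ nabla l i j x
      = 1 / 2 * (partialDeriv φ i (fun y ↦ metricMatrix φ g y j m) x
        + partialDeriv φ j (fun y ↦ metricMatrix φ g y i m) x
        - partialDeriv φ m (fun y ↦ metricMatrix φ g y i j) x) := by
  have hs (a b : Fin n) : metricMatrix φ g x a b = metricMatrix φ g x b a :=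
    g.symm x _ _
  have e (a b c : Fin n) : ∑ l, christoffel φ nabla l a b x * metricMatrix φ g x l c
      = ∑ l, metricMatrix φ g x c l * christoffel φ nabla l a b x :=
    Finset.sum_congr rfl fun l _ ↦ by rw [hs l c, mul_comm]
  have f (a b c : Fin n) : ∑ l, metricMatrix φ g x c l * christoffel φ nabla l a b x
      = ∑ l, metricMatrix φ g x c l * christoffel φ nabla l b a x :=
    Finset.sum_congr rfl fun l _ ↦ by rw [christoffel_symm hφ hx hn]
  simp only [partialDeriv_metricMatrix hφ hx hn, e]
  rw [f j i m, f m i j, f m j i]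
  ring

/-- The covariant derivative of a combination of the coordinate fields, by the Leibniz rule. As the
connection is local, the expansion is only needed on the chart domain. -/
theorem coordForm_nabla_of_eqOn (hφ : φ ∈ IsManifold.maximalAtlas (𝓡 n) ∞ M) (hx : x ∈ φ.source)
    {Z : Π y : M, TangentSpace (𝓡 n) y} {c : Fin n → M → ℝ}
    (hc : ∀ m, MDifferentiableAt (𝓡 n) 𝓘(ℝ, ℝ) (c m) x)
    (hZ : ∀ y ∈ φ.source, Z y = ∑ m, c m y • coordField φ m y) (i l : Fin n) :
    coordForm φ l x (nabla Z x (coordField φ i x))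
      = partialDeriv φ i (c l) x + ∑ m, christoffel φ nabla l i m x * c m x := by
  have hterm (m : Fin n) : MDifferentiableAt (𝓡 n) (𝓡 n).tangent
      (T% (c m • coordField φ m)) x :=
    (hc m).smul_section (mdifferentiableAt_coordField hφ hx m)
  have hsum (s : Finset (Fin n)) : MDifferentiableAt (𝓡 n) (𝓡 n).tangent
        (T% (∑ m ∈ s, c m • coordField φ m)) x ∧
      nabla (∑ m ∈ s, c m • coordField φ m) x
        = ∑ m ∈ s, nabla (c m • coordField φ m) x := by
    classical
    induction s using Finset.induction_on with
    | empty =>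
      simp only [Finset.sum_empty]
      refine ⟨?_, ?_⟩
      · exact Bundle.mdifferentiableAt_zeroSection ..
      · rw [nabla.zero]; rfl
    | insert a s ha ih =>
      rw [Finset.sum_insert ha, Finset.sum_insert ha]
      refine ⟨mdifferentiableAt_add_section (hterm a) ih.1, ?_⟩
      rw [nabla.isCovariantDerivativeOnUniv.add (hterm a) ih.1, ih.2]
  have heq : ∀ᶠ y in nhds x, (∑ m, c m • coordField φ m) y = Z y := by
    filter_upwards [φ.open_source.mem_nhds hx] with y hy
    rw [hZ y hy, Finset.sum_apply]
    rfl
  have hdZ : MDifferentiableAt (𝓡 n) (𝓡 n).tangent (T% Z) x := by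
    refine (hsum Finset.univ).1.congr_of_eventuallyEq ?_
    filter_upwards [heq] with y hy
    rw [hy]
  rw [← nabla.isCovariantDerivativeOnUniv.congr_of_eventuallyEq (hsum Finset.univ).1 hdZ
    Filter.univ_mem heq, (hsum Finset.univ).2]
  simp only [nabla.isCovariantDerivativeOnUniv.leibniz (mdifferentiableAt_coordField hφ hx _)
    (hc _), sum_apply, add_apply,
    smul_apply, ContinuousLinearMap.smulRight_apply, map_sum, map_add,
    map_smul, coordForm_coordField hφ hx, Finset.sum_add_distrib, smul_eq_mul, mul_ite, mul_one,
    mul_zero, Finset.sum_ite_eq, Finset.mem_univ, if_true]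
  rw [add_comm]
  congr 1
  exact Finset.sum_congr rfl fun m _ ↦ mul_comm _ _

/-- The coordinate expression of the curvature tensor. -/
theorem curvatureComp_eq (hφ : φ ∈ IsManifold.maximalAtlas (𝓡 n) ∞ M) (hx : x ∈ φ.source)
    (hc : ∀ l i j, MDifferentiableAt (𝓡 n) 𝓘(ℝ, ℝ) (christoffel φ nabla l i j) x)
    (l k i j : Fin n) :
    curvatureComp φ nabla l k i j x
      = partialDeriv φ i (christoffel φ nabla l j k) x
        - partialDeriv φ j (christoffel φ nabla l i k) x
        + ∑ m, christoffel φ nabla l i m x * christoffel φ nabla m j k x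
        - ∑ m, christoffel φ nabla l j m x * christoffel φ nabla m i k x := by
  unfold curvatureComp curvature
  rw [mlieBracket_coordField hφ hx, map_zero, sub_zero, map_sub,
    coordForm_nabla_of_eqOn hφ hx (fun m ↦ hc m j k) (fun y hy ↦ nabla_coordField hφ hy j k),
    coordForm_nabla_of_eqOn hφ hx (fun m ↦ hc m i k) (fun y hy ↦ nabla_coordField hφ hy i k)]
  ring

end PseudoRiemannian

namespace PseudoRiemannian

variable {n : ℕ} {M : Type*} [TopologicalSpace M]
  [ChartedSpace (EuclideanSpace ℝ (Fin n)) M] [IsManifold (𝓡 n) ∞ M]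
  {φ : OpenPartialHomeomorph M (EuclideanSpace ℝ (Fin n))} {x : M}
  {g : Metric n M} {nabla : Connection n M}

/-! ### The metric and the connection as matrices of smooth functions -/

open Classical in
/-- The matrix of the metric over the algebra of smooth functions on the chart domain. Off the
domain it is the identity matrix, so that it is invertible everywhere. -/
def smoothMetric (hφ : φ ∈ IsManifold.maximalAtlas (𝓡 n) ∞ M) (g : Metric n M) :
    Matrix (Fin n) (Fin n) (smoothAlgebra φ) :=
  Matrix.of fun i j ↦
    ⟨fun y ↦ if y ∈ φ.source then metricMatrix φ g y i j else (1 : Matrix (Fin n) (Fin n) ℝ) i j,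
      (contMDiffOn_metricMatrix hφ g i j).congr fun _ hy ↦ if_pos hy⟩

theorem smoothMetric_apply (hφ : φ ∈ IsManifold.maximalAtlas (𝓡 n) ∞ M) (hx : x ∈ φ.source)
    (i j : Fin n) : (smoothMetric hφ g i j : M → ℝ) x = metricMatrix φ g x i j :=
  if_pos hx

theorem smoothMetric_apply_of_notMem (hφ : φ ∈ IsManifold.maximalAtlas (𝓡 n) ∞ M)
    (hx : x ∉ φ.source) (i j : Fin n) :
    (smoothMetric hφ g i j : M → ℝ) x = (1 : Matrix (Fin n) (Fin n) ℝ) i j :=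
  if_neg hx

theorem smoothMetric_transpose (hφ : φ ∈ IsManifold.maximalAtlas (𝓡 n) ∞ M) (g : Metric n M) :
    (smoothMetric hφ g).transpose = smoothMetric hφ g := by
  ext i j x
  rw [Matrix.transpose_apply]
  by_cases hx : x ∈ φ.source
  · rw [smoothMetric_apply hφ hx, smoothMetric_apply hφ hx]
    exact g.symm x _ _
  · rw [smoothMetric_apply_of_notMem hφ hx, smoothMetric_apply_of_notMem hφ hx]
    exact congrFun₂ Matrix.transpose_one i j

theorem isUnit_det_smoothMetric (hφ : φ ∈ IsManifold.maximalAtlas (𝓡 n) ∞ M) (g : Metric n M) :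
    IsUnit (smoothMetric hφ g).det := by
  refine isUnit_of_forall_ne_zero fun x ↦ ?_
  rw [← evalAt_apply, RingHom.map_det]
  by_cases hx : x ∈ φ.source
  · have h : (evalAt φ x).mapMatrix (smoothMetric hφ g) = metricMatrix φ g x := by
      ext i j
      exact smoothMetric_apply hφ hx i j
    rw [h]
    exact (isUnit_det_metricMatrix hφ hx g).ne_zero
  · have h : (evalAt φ x).mapMatrix (smoothMetric hφ g) = 1 := by
      ext i j
      exact smoothMetric_apply_of_notMem hφ hx i j
    rw [h, Matrix.det_one]
    exact one_ne_zero

theorem smoothMetric_inv_apply (hφ : φ ∈ IsManifold.maximalAtlas (𝓡 n) ∞ M) (hx : x ∈ φ.source)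
    (i j : Fin n) : ((smoothMetric hφ g)⁻¹ i j : M → ℝ) x = metricInv φ g x i j := by
  have h : (evalAt φ x).mapMatrix (smoothMetric hφ g) = metricMatrix φ g x := by
    ext i j
    exact smoothMetric_apply hφ hx i j
  have h1 := congrArg (evalAt φ x).mapMatrix
    (Matrix.nonsing_inv_mul _ (isUnit_det_smoothMetric hφ g))
  rw [map_mul, h, map_one] at h1
  exact (congrFun₂ (Matrix.inv_eq_left_inv h1) i j).symm

/-- The Christoffel symbols are smooth, by the Koszul formula. -/
theorem contMDiffOn_christoffel (hφ : φ ∈ IsManifold.maximalAtlas (𝓡 n) ∞ M)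
    (hn : IsLeviCivita g nabla) (l i j : Fin n) :
    ContMDiffOn (𝓡 n) 𝓘(ℝ, ℝ) ∞ (christoffel φ nabla l i j) φ.source := by
  let d (a b c : Fin n) := coordDerivation hφ a (smoothMetric hφ g b c)
  let K : smoothAlgebra φ := ∑ m, (smoothMetric hφ g)⁻¹ l m *
    ((1 / 2 : ℝ) • (d i j m + d j i m - d m i j))
  refine ContMDiffOn.congr K.2 fun y hy ↦ ?_
  have hd (a b c : Fin n) : (d a b c : M → ℝ) y
      = partialDeriv φ a (fun y ↦ metricMatrix φ g y b c) y := by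
    rw [coordDerivation_apply hφ a _ hy]
    exact partialDeriv_congr hy (fun z hz ↦ smoothMetric_apply hφ hz b c) a
  have hK : (K : M → ℝ) y = ∑ m, metricInv φ g y l m *
      ∑ p, metricMatrix φ g y m p * christoffel φ nabla p i j y := by
    rw [← evalAt_apply, map_sum]
    refine Finset.sum_congr rfl fun m _ ↦ ?_
    rw [koszul hφ hy hn, ← hd, ← hd, ← hd, ← smoothMetric_inv_apply hφ hy]
    rfl
  rw [hK]
  have hinv := Matrix.nonsing_inv_mul _ (isUnit_det_metricMatrix hφ hy g)
  change _ = (Matrix.mulVec (metricMatrix φ g y)⁻¹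
    (Matrix.mulVec (metricMatrix φ g y) fun p ↦ christoffel φ nabla p i j y)) l
  rw [Matrix.mulVec_mulVec, hinv, Matrix.one_mulVec]

/-- The connection matrices `(Γ_i)ˡ_j = Γˡ_{ij}` over the algebra of smooth functions on the chart
domain, extended by zero off the domain. -/
def smoothConnection (hφ : φ ∈ IsManifold.maximalAtlas (𝓡 n) ∞ M) (hn : IsLeviCivita g nabla)
    (i : Fin n) : Matrix (Fin n) (Fin n) (smoothAlgebra φ) :=
  Matrix.of fun l j ↦ ⟨φ.source.indicator (christoffel φ nabla l i j),
    (contMDiffOn_christoffel hφ hn l i j).congr fun _ hy ↦ Set.indicator_of_mem hy _⟩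

theorem smoothConnection_apply (hφ : φ ∈ IsManifold.maximalAtlas (𝓡 n) ∞ M)
    (hn : IsLeviCivita g nabla) (hx : x ∈ φ.source) (i l j : Fin n) :
    (smoothConnection hφ hn i l j : M → ℝ) x = christoffel φ nabla l i j x :=
  Set.indicator_of_mem hx _

theorem smoothConnection_apply_of_notMem (hφ : φ ∈ IsManifold.maximalAtlas (𝓡 n) ∞ M)
    (hn : IsLeviCivita g nabla) (hx : x ∉ φ.source) (i l j : Fin n) :
    (smoothConnection hφ hn i l j : M → ℝ) x = 0 :=
  Set.indicator_of_notMem hx _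

theorem smoothConnection_symm (hφ : φ ∈ IsManifold.maximalAtlas (𝓡 n) ∞ M)
    (hn : IsLeviCivita g nabla) (i j l : Fin n) :
    smoothConnection hφ hn i l j = smoothConnection hφ hn j l i := by
  ext x
  by_cases hx : x ∈ φ.source
  · rw [smoothConnection_apply hφ hn hx, smoothConnection_apply hφ hn hx,
      christoffel_symm hφ hx hn]
  · rw [smoothConnection_apply_of_notMem hφ hn hx, smoothConnection_apply_of_notMem hφ hn hx]

/-- Metric compatibility. Off the chart domain both sides vanish by the choice of extensions. -/
theorem map_coordDerivation_smoothMetric (hφ : φ ∈ IsManifold.maximalAtlas (𝓡 n) ∞ M)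
    (hn : IsLeviCivita g nabla) (k : Fin n) :
    (smoothMetric hφ g).map (coordDerivation hφ k)
      = (smoothConnection hφ hn k).transpose * smoothMetric hφ g
        + smoothMetric hφ g * smoothConnection hφ hn k := by
  ext i j x
  rw [Matrix.map_apply, Matrix.add_apply, Matrix.mul_apply, Matrix.mul_apply, ← evalAt_apply x,
    ← evalAt_apply x, map_add, map_sum, map_sum]
  simp only [map_mul, evalAt_apply, Matrix.transpose_apply]
  by_cases hx : x ∈ φ.source
  · simp only [coordDerivation_apply hφ k _ hx, smoothConnection_apply hφ hn hx,
      smoothMetric_apply hφ hx]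
    rw [← partialDeriv_metricMatrix hφ hx hn]
    exact partialDeriv_congr hx (fun z hz ↦ smoothMetric_apply hφ hz i j) k
  · simp [coordDerivation_apply_of_notMem hφ k _ hx, smoothConnection_apply_of_notMem hφ hn hx]

theorem curvatureMatrix_apply (hφ : φ ∈ IsManifold.maximalAtlas (𝓡 n) ∞ M)
    (hn : IsLeviCivita g nabla) (hx : x ∈ φ.source) (l k i j : Fin n) :
    ((Algebraic.curvatureMatrix (coordDerivation hφ) (smoothConnection hφ hn) i j l k :
      smoothAlgebra φ) : M → ℝ) x
      = curvatureComp φ nabla l k i j x := by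
  have hc (l i j : Fin n) : MDifferentiableAt (𝓡 n) 𝓘(ℝ, ℝ) (christoffel φ nabla l i j) x :=
    ((contMDiffOn_christoffel hφ hn l i j).contMDiffAt
      (φ.open_source.mem_nhds hx)).mdifferentiableAt (by simp)
  have hd (a l i j : Fin n) :
      partialDeriv φ a (smoothConnection hφ hn i l j : smoothAlgebra φ) x
        = partialDeriv φ a (christoffel φ nabla l i j) x :=
    partialDeriv_congr hx (fun z hz ↦ smoothConnection_apply hφ hn hz i l j) a
  rw [curvatureComp_eq hφ hx hc, ← evalAt_apply, Algebraic.curvatureMatrix, Matrix.sub_apply,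
    Matrix.add_apply, Matrix.sub_apply, Matrix.mul_apply, Matrix.mul_apply, Matrix.map_apply,
    Matrix.map_apply]
  simp only [map_add, map_sub, map_sum, map_mul, evalAt_apply, coordDerivation_apply hφ _ _ hx,
    smoothConnection_apply hφ hn hx, hd]

theorem ricciMatrix_apply (hφ : φ ∈ IsManifold.maximalAtlas (𝓡 n) ∞ M)
    (hn : IsLeviCivita g nabla) (hx : x ∈ φ.source) (k j : Fin n) :
    ((Algebraic.ricciMatrix (coordDerivation hφ) (smoothConnection hφ hn) k j :
      smoothAlgebra φ) : M → ℝ) x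
      = ricci φ nabla k j x := by
  rw [← evalAt_apply, Algebraic.ricciMatrix, Matrix.of_apply, map_sum]
  exact Finset.sum_congr rfl fun s _ ↦ curvatureMatrix_apply hφ hn hx s j s k

theorem trace_ricciMatrix_apply (hφ : φ ∈ IsManifold.maximalAtlas (𝓡 n) ∞ M)
    (hn : IsLeviCivita g nabla) (hx : x ∈ φ.source) :
    ((Matrix.trace ((smoothMetric hφ g)⁻¹ *
      Algebraic.ricciMatrix (coordDerivation hφ) (smoothConnection hφ hn)) :
      smoothAlgebra φ) : M → ℝ) x
      = scalarCurvature φ g nabla x := by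
  have hs (i j : Fin n) : metricInv φ g x j i = metricInv φ g x i j := by
    have h := Matrix.transpose_nonsing_inv (metricMatrix φ g x)
    rw [metricMatrix_transpose] at h
    exact congrFun₂ h i j
  rw [← evalAt_apply, Matrix.trace, map_sum]
  simp only [Matrix.diag_apply, Matrix.mul_apply, map_sum, map_mul, evalAt_apply,
    smoothMetric_inv_apply hφ hx, ricciMatrix_apply hφ hn hx]
  unfold scalarCurvature
  rw [Finset.sum_comm]
  simp only [hs]

/-- The mixed Hilbert–Einstein–Cartan tensor as a matrix of smooth functions. -/
def smoothHec (hφ : φ ∈ IsManifold.maximalAtlas (𝓡 n) ∞ M) (hn : IsLeviCivita g nabla) :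
    Matrix (Fin n) (Fin n) (smoothAlgebra φ) :=
  let S := Algebraic.ricciMatrix (coordDerivation hφ) (smoothConnection hφ hn)
  (smoothMetric hφ g)⁻¹ *
    (S - (1 / 2 : ℝ) • Matrix.trace ((smoothMetric hφ g)⁻¹ * S) • smoothMetric hφ g)

theorem smoothHec_apply (hφ : φ ∈ IsManifold.maximalAtlas (𝓡 n) ∞ M)
    (hn : IsLeviCivita g nabla) (hx : x ∈ φ.source) (i j : Fin n) :
    (smoothHec hφ hn i j : M → ℝ) x = hecMixed φ g nabla i j x := by
  rw [← evalAt_apply, smoothHec, Matrix.mul_apply, map_sum]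
  refine Finset.sum_congr rfl fun k _ ↦ ?_
  rw [map_mul, evalAt_apply, smoothMetric_inv_apply hφ hx]
  congr 1
  rw [Matrix.sub_apply, Matrix.smul_apply, Matrix.smul_apply, smul_eq_mul, map_sub, evalAt_apply,
    ricciMatrix_apply hφ hn hx]
  unfold hec
  rw [← trace_ricciMatrix_apply hφ hn hx, ← smoothMetric_apply hφ hx k j]
  change _ - (1 / 2 : ℝ) * (_ * _) = _
  ring

theorem covDerivEnd_smoothHec_apply (hφ : φ ∈ IsManifold.maximalAtlas (𝓡 n) ∞ M)
    (hn : IsLeviCivita g nabla) (hx : x ∈ φ.source) (i j k : Fin n) :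
    ((Algebraic.covDerivEnd (coordDerivation hφ) (smoothConnection hφ hn) k (smoothHec hφ hn) i j :
      smoothAlgebra φ) : M → ℝ) x
      = covDerivComp φ nabla (hecMixed φ g nabla) i j k x := by
  have hd : partialDeriv φ k (smoothHec hφ hn i j : smoothAlgebra φ) x
      = partialDeriv φ k (hecMixed φ g nabla i j) x :=
    partialDeriv_congr hx (fun z hz ↦ smoothHec_apply hφ hn hz i j) k
  rw [← evalAt_apply, Algebraic.covDerivEnd, Matrix.sub_apply, Matrix.add_apply, Matrix.map_apply,
    Matrix.mul_apply, Matrix.mul_apply]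
  simp only [map_sub, map_add, map_sum, map_mul, evalAt_apply, coordDerivation_apply hφ _ _ hx,
    smoothConnection_apply hφ hn hx, smoothHec_apply hφ hn hx, hd]
  unfold covDerivComp
  congr 1
  exact Finset.sum_congr rfl fun a _ ↦ mul_comm _ _

end PseudoRiemannian

end

theorem mainTheorem5 (n : ℕ) (M : Type*) [TopologicalSpace M]
    [ChartedSpace (EuclideanSpace ℝ (Fin n)) M] [IsManifold (𝓡 n) ∞ M]
    (g : PseudoRiemannian.Metric n M) (nabla : PseudoRiemannian.Connection n M)
    (h_nabla : PseudoRiemannian.IsLeviCivita g nabla)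
    (φ : OpenPartialHomeomorph M (EuclideanSpace ℝ (Fin n)))
    (h_chart : φ ∈ IsManifold.maximalAtlas (𝓡 n) ∞ M)
    (x : M) (hx : x ∈ φ.source) (j : Fin n) :
    PseudoRiemannian.divergence φ nabla
      (PseudoRiemannian.hecMixed φ g nabla) j x = 0 := by
  have h := PseudoRiemannian.Algebraic.divergence_einstein
    (PseudoRiemannian.coordDerivation_comm h_chart)
    (PseudoRiemannian.smoothConnection_symm h_chart h_nabla)
    (PseudoRiemannian.smoothMetric_transpose h_chart g)
    (Matrix.nonsing_inv_mul _ (PseudoRiemannian.isUnit_det_smoothMetric h_chart g))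
    (PseudoRiemannian.map_coordDerivation_smoothMetric h_chart h_nabla) j
  have hx' := congrArg (PseudoRiemannian.evalAt φ x) h
  rw [map_sum, map_zero] at hx'
  rw [← hx']
  exact Finset.sum_congr rfl fun i _ ↦
    (PseudoRiemannian.covDerivEnd_smoothHec_apply h_chart h_nabla hx i j i).symm
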